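/- For a finite graph $G$ and $b\ge 1$ let $\chi_b(G)$ be the least $m$ for which one can assign to every vertex a $b$-element subset of $\{1,\dots,m\}$ so that adjacent vertices receive disjoint subsets, and let $\chi_f(G)=\inf_{b\ge 1}\chi_b(G)/b$ be the fractional chromatic number of $G$. A graph is $4$-edge-critical if its chromatic number is $4$ and the removal of any edge decreases the chromatic number. The crowning of a graph $G$ at a triangle $t_0t_1t_2$ (indices modulo $3$) is the graph obtained from $G$ by replacing each edge $t_it_{i+1}$ by a path $t_i\,x_i\,y_i\,t_{i+1}$ with two new vertices $x_i,y_i$, adding the edges $y_ix_{i+1}$, and adding a triangle $z_0z_1z_2$ on three further new vertices, together with the edges $z_ix_i$ and $z_iy_i$ (for $i=0,1,2$). Theorem. There is an infinite sequence $G_0,G_1,G_2,\dots$ of $4$-edge-critical $4$-regular planar graphs with $\chi_f(G_k)=3$ for all $k$, such that $G_0$ has $18$ vertices and, for every $k$, $G_{k+1}$ is (isomorphic to) the crowning of $G_k$ at a triangle that bounds a face in some plane drawing of $G_k$; in particular $G_k$ has $18+9k$ vertices, so the graphs are pairwise non-isomorphic. Consequently it is not true that every finite planar graph with chromatic number $4$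 has fractional chromatic number strictly greater than $3$ (a conjecture of Gimbel, Kündgen, Li and Thomassen). -/

import Mathlib

noncomputable section

/-- A drawing of a graph in the plane without crossings: distinct vertices are distinct points,
every edge is a simple arc between its two ends that contains no other vertex, and two
different edges meet at most in points that represent a vertex. (`arc` is only relevant on the
edges of `G`.) -/
structure PlaneDrawing {V : Type*} (G : SimpleGraph V) where
  point : V → ℝ × ℝ
  arc : Sym2 V → Set (ℝ × ℝ)
  point_injective : Function.Injective point
  arc_simple : ∀ u v, G.Adj u v →
    ∃ γ : Path (point u) (point v), Function.Injective γ ∧ Set.range γ = arc s(u, v)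
  mem_of_point_mem_arc : ∀ e ∈ G.edgeSet, ∀ v, point v ∈ arc e → v ∈ e
  arc_inter_arc : ∀ e ∈ G.edgeSet, ∀ f ∈ G.edgeSet, e ≠ f → arc e ∩ arc f ⊆ Set.range point

namespace PlaneDrawing

variable {V : Type*} {G : SimpleGraph V}

/-- The set of all points of the plane that belong to the drawn graph. -/
def carrier (D : PlaneDrawing G) : Set (ℝ × ℝ) :=
  Set.range D.point ∪ ⋃ e ∈ G.edgeSet, D.arc e

/-- The faces: the connected components of the complement of the drawn graph. -/
def IsFace (D : PlaneDrawing G) (F : Set (ℝ × ℝ)) : Prop :=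
  ∃ x ∈ D.carrierᶜ, F = connectedComponentIn D.carrierᶜ x

/-- `t 0, t 1, t 2` is a triangle of `G` that bounds a face of the drawing. -/
def IsFacialTriangle (D : PlaneDrawing G) (t : Fin 3 → V) : Prop :=
  (∀ i, G.Adj (t i) (t (i + 1))) ∧
    ∃ F, D.IsFace F ∧ frontier F = ⋃ i, D.arc s(t i, t (i + 1))

end PlaneDrawing

namespace SimpleGraph

variable {V : Type*}

/-- A graph is planar if it can be drawn in the plane without crossings. -/
def IsPlanar (G : SimpleGraph V) : Prop := Nonempty (PlaneDrawing G)

/-- `G` is `k`-chromatic and the removal of any edge decreases the chromatic number. -/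
def IsEdgeCritical (G : SimpleGraph V) (k : ℕ) : Prop :=
  G.chromaticNumber = k ∧
    ∀ e ∈ G.edgeSet, (G.deleteEdges {e}).chromaticNumber < G.chromaticNumber

/-- `c` assigns to every vertex a set of `b` out of `m` colors such that adjacent vertices get
disjoint sets. -/
def IsFoldColoring (G : SimpleGraph V) (b m : ℕ) (c : V → Finset (Fin m)) : Prop :=
  (∀ v, (c v).card = b) ∧ ∀ u v, G.Adj u v → Disjoint (c u) (c v)

/-- The `b`-chromatic number of a finite graph: the least number of colors in a `b`-fold
coloring. -/
def foldChromaticNumber (G : SimpleGraph V) (b : ℕ) : ℕ :=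
  sInf {m : ℕ | ∃ c : V → Finset (Fin m), G.IsFoldColoring b m c}

/-- The fractional chromatic number of a finite graph, `inf_{b ≥ 1} χ_b(G) / b`. -/
def fractionalChromaticNumber (G : SimpleGraph V) : ℝ :=
  ⨅ b : ℕ+, (G.foldChromaticNumber b : ℝ) / (b : ℝ)

/-- The vertices of the crowning at a triangle: the old vertices and nine new ones
`x 0, x 1, x 2`, `y 0, y 1, y 2`, `z 0, z 1, z 2`, in this order. -/
abbrev CrownVertex (V : Type*) : Type _ := V ⊕ Fin 3 ⊕ Fin 3 ⊕ Fin 3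

/-- One orientation of each edge of the crowning at the triangle `t 0, t 1, t 2`. Each side
`t i, t (i + 1)` is replaced by a path `t i, x i, y i, t (i + 1)`; at every corner `t (i + 1)` its
two new neighbors `y i` and `x (i + 1)` are joined, which closes a hexagon of the `x i, y i`; and
a triangle `z 0, z 1, z 2` is put inside the hexagon, with `z i` joined to `x i` and `y i`. -/
def crownRel (G : SimpleGraph V) (t : Fin 3 → V) : CrownVertex V → CrownVertex V → Prop
  | .inl u, .inl v => G.Adj u v ∧ ¬ ((∃ i, u = t i) ∧ ∃ j, v = t j)
  | .inl u, .inr (.inl i) => u = t i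
  | .inl u, .inr (.inr (.inl i)) => u = t (i + 1)
  | .inr (.inl i), .inr (.inr (.inl j)) => i = j ∨ i = j + 1
  | .inr (.inr (.inr i)), .inr (.inl j) => i = j
  | .inr (.inr (.inr i)), .inr (.inr (.inl j)) => i = j
  | .inr (.inr (.inr i)), .inr (.inr (.inr j)) => i ≠ j
  | _, _ => False

/-- The graph obtained from `G` by crowning the triangle `t 0, t 1, t 2`. -/
def crown (G : SimpleGraph V) (t : Fin 3 → V) : SimpleGraph (CrownVertex V) :=
  SimpleGraph.fromRel (G.crownRel t)

end SimpleGraph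

end

/-!
A crowning `G.crown t` consists of `G` without the sides of the triangle `t` and of a gadget, the
crowning of a single triangle. Mapping the new vertices to the triangle folds the crowning onto
`G`, so a 2-fold coloring with 6 colors pulls back from `G` to all later graphs; since they contain
triangles, their fractional chromatic number is 3.

In every 3-coloring of the gadget its three corners get three different colors, so a 3-coloring of
the crowning would be a 3-coloring of `G`. Once an edge of the gadget is deleted, it has a
3-coloring in which two corners agree, and this one is compatible with a 3-coloring of `G` minus a
side of the triangle. The other edges of the crowning are edges of `G`, and for them the fold works.

The gadget can be drawn inside its triangle of corners, and hence, by an affine map, inside an empty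
triangle of any straight-line drawing; the triangle in the middle of the gadget is empty again.
-/

open Set SimpleGraph

section Convexity

variable {E : Type*} [AddCommGroup E] [Module ℝ E]

theorem mem_convexHull_inter_zeros {A : Set E} {q : E} {f : E →ᵃ[ℝ] ℝ} (hA : ∀ a ∈ A, f a ≤ 0)
    (hq : q ∈ convexHull ℝ A) (hfq : f q = 0) : q ∈ convexHull ℝ (A ∩ {a | f a = 0}) := by
  suffices h : convexHull ℝ A ⊆ {x | f x ≤ 0 ∧ (f x = 0 → x ∈ convexHull ℝ (A ∩ {a | f a = 0}))}
    from (h hq).2 hfq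
  refine convexHull_min (fun a ha => ⟨hA a ha, fun h => subset_convexHull ℝ _ ⟨ha, h⟩⟩)
    (convex_iff_forall_pos.2 fun x hx y hy a b ha hb hab => ?_)
  have hf : f (a • x + b • y) = a * f x + b * f y := Convex.combo_affine_apply hab
  rw [mem_ofPred_eq, hf]
  refine ⟨by nlinarith [hx.1, hy.1], fun h => ?_⟩
  have hfx : f x = 0 := by nlinarith [hx.1, hy.1]
  have hfy : f y = 0 := by nlinarith [hx.1, hy.1]
  exact convex_convexHull ℝ _ (hx.2 hfx) (hy.2 hfy) ha.le hb.le hab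

theorem convexHull_inter_subset_of_separated {A B : Set E} {f : E →ᵃ[ℝ] ℝ}
    (hA : ∀ a ∈ A, f a ≤ 0 ∧ (f a = 0 → a ∈ B)) (hB : ∀ b ∈ B, 0 ≤ f b) :
    convexHull ℝ A ∩ convexHull ℝ B ⊆ convexHull ℝ (A ∩ B) := by
  rintro q ⟨hqA, hqB⟩
  have hle : f q ≤ 0 :=
    convexHull_min (fun a ha => (hA a ha).1) ((convex_Iic (0 : ℝ)).affine_preimage f) hqA
  have hge : 0 ≤ f q := convexHull_min hB ((convex_Ici (0 : ℝ)).affine_preimage f) hqB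
  refine convexHull_mono (fun a ha => ?_)
    (mem_convexHull_inter_zeros (fun a ha => (hA a ha).1) hqA (hle.antisymm hge))
  exact ⟨ha.1, (hA a ha.1).2 ha.2⟩

theorem frontier_convexHull_range_affineBasis {ι E : Type*} [Finite ι] [NormedAddCommGroup E]
    [NormedSpace ℝ E] (b : AffineBasis ι ℝ E) :
    frontier (interior (convexHull ℝ (range b))) = ⋃ i, convexHull ℝ (b '' {i}ᶜ) := by
  have := Fintype.ofFinite ι
  have hclosure : closure (interior (convexHull ℝ (range b))) = convexHull ℝ (range b) := by
    rw [(convex_convexHull ℝ _).closure_interior_eq_closure_of_nonempty_interior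
      ⟨_, b.centroid_mem_interior_convexHull⟩, ((finite_range b).isClosed_convexHull ℝ).closure_eq]
  ext q
  rw [isOpen_interior.frontier_eq, hclosure, b.interior_convexHull, mem_iUnion]
  constructor
  · rintro ⟨hq, hqi⟩
    have hnonneg := hq
    rw [b.convexHull_eq_nonneg_coord] at hnonneg
    obtain ⟨i, hi⟩ : ∃ i, b.coord i q ≤ 0 := by simpa using hqi
    refine ⟨i, convexHull_mono ?_ (mem_convexHull_inter_zeros (f := -b.coord i) ?_ hq ?_)⟩
    · rintro _ ⟨⟨j, rfl⟩, hj⟩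
      refine mem_image_of_mem b fun hji => ?_
      obtain rfl : j = i := hji
      simp at hj
    · rintro _ ⟨j, rfl⟩
      by_cases h : i = j <;> simp [h]
    · simpa using hi.antisymm (hnonneg i)
  · rintro ⟨i, hi⟩
    refine ⟨convexHull_mono (image_subset_range _ _) hi, fun hq => (hq i).ne' ?_⟩
    have hsub : b '' {i}ᶜ ⊆ b.coord i ⁻¹' {0} := by
      rintro _ ⟨j, hj, rfl⟩
      exact b.coord_apply_ne (Ne.symm hj)
    exact convexHull_min hsub ((convex_singleton (0 : ℝ)).affine_preimage (b.coord i)) hi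

/-- Three affinely independent points of the plane as an affine basis. -/
def planeAffineBasis {q : Fin 3 → ℝ × ℝ} (hq : AffineIndependent ℝ q) :
    AffineBasis (Fin 3) ℝ (ℝ × ℝ) where
  toFun := q
  ind' := hq
  tot' := hq.affineSpan_eq_top_iff_card_eq_finrank_add_one.2 (by simp)

theorem exists_injective_affineMap {k ι V P V' P' : Type*} [DivisionRing k]
    [AddCommGroup V] [Module k V] [AddTorsor V P] [AddCommGroup V'] [Module k V']
    [AddTorsor V' P'] (b : AffineBasis ι k P) {q : ι → P'} (hq : AffineIndependent k q) :
    ∃ φ : P →ᵃ[k] P', Function.Injective φ ∧ ∀ i, φ (b i) = q i := by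
  obtain ⟨i₀⟩ := b.nonempty
  have hlin := (affineIndependent_iff_linearIndependent_vsub k q i₀).1 hq
  let L := (b.basisOf i₀).constr ℕ fun j => q j -ᵥ q i₀
  refine ⟨⟨fun x => L (x -ᵥ b i₀) +ᵥ q i₀, L, fun x v => ?_⟩, fun x y hxy => ?_, fun i => ?_⟩
  · rw [vadd_vsub_assoc, map_add, vadd_vadd]
  · have hL : Function.Injective L := (b.basisOf i₀).injective_constr_of_linearIndependent hlin
    simpa [hL.eq_iff] using hxy
  · rcases eq_or_ne i i₀ with rfl | hi
    · simp
    · have hLi : L (b i -ᵥ b i₀) = q i -ᵥ q i₀ := by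
        simpa using (b.basisOf i₀).constr_basis ℕ (fun j => q j -ᵥ q i₀) ⟨i, hi⟩
      simp [hLi]

end Convexity

theorem connectedComponentIn_eq_of_disjoint_frontier {X : Type*} [TopologicalSpace X]
    {U F : Set X} {x : X} (hU : IsOpen U) (hconn : IsPreconnected U) (hUF : U ⊆ F)
    (hfr : Disjoint F (frontier U)) (hx : x ∈ U) : connectedComponentIn F x = U := by
  refine Subset.antisymm ?_ (hconn.subset_connectedComponentIn hx hUF)
  refine isPreconnected_connectedComponentIn.subset_left_of_subset_union hU
    isClosed_closure.isOpen_compl (disjoint_compl_right.mono_left subset_closure) (fun y hy => ?_)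
    ⟨x, mem_connectedComponentIn (hUF hx), hx⟩
  by_contra! h
  exact Set.disjoint_left.1 hfr (connectedComponentIn_subset F x hy)
    (hU.frontier_eq ▸ ⟨by simpa using fun hn => h (.inr hn), fun hn => h (.inl hn)⟩)

/-- The cells of a graph with a distinguished triangle `t`, as sets of vertices: the vertices, the
edges and the triangle. -/
inductive IsCell {V : Type*} (G : SimpleGraph V) (t : Fin 3 → V) : Set V → Prop
  | vertex (v : V) : IsCell G t {v}
  | edge {e : Sym2 V} (he : e ∈ G.edgeSet) : IsCell G t e
  | triangle : IsCell G t (range t)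

/-- The convex hulls of two cells intersect in the convex hull of their common vertices, as in a
simplicial complex. -/
def MeetProperly {V E : Type*} [AddCommGroup E] [Module ℝ E] (p : V → E) (s s' : Set V) : Prop :=
  convexHull ℝ (p '' s) ∩ convexHull ℝ (p '' s') ⊆ convexHull ℝ (p '' (s ∩ s'))

/-- A straight-line drawing `p` of `G` in which the inside of the triangle `t` is empty: the convex
hulls of the cells form a simplicial complex. -/
structure TriangleDrawing {V E : Type*} [AddCommGroup E] [Module ℝ E] (G : SimpleGraph V)
    (t : Fin 3 → V) (p : V → E) : Prop where
  affineIndependent : AffineIndependent ℝ (p ∘ t)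
  meetProperly : ∀ {s s' : Set V}, IsCell G t s → IsCell G t s' → MeetProperly p s s'

namespace MeetProperly

variable {V E : Type*} [AddCommGroup E] [Module ℝ E] {p : V → E} {s s' : Set V}

theorem self (s : Set V) : MeetProperly p s s := by
  simp [MeetProperly]

theorem symm (h : MeetProperly p s s') : MeetProperly p s' s := by
  simpa only [MeetProperly, inter_comm] using h

theorem image {W : Type*} {q : W → E} {f : V → W} (hf : Function.Injective f)
    (h : MeetProperly (q ∘ f) s s') : MeetProperly q (f '' s) (f '' s') := by
  simpa only [MeetProperly, ← image_inter hf, ← image_comp] using h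

theorem affineMap_comp {F : Type*} [AddCommGroup F] [Module ℝ F] {φ : E →ᵃ[ℝ] F}
    (hφ : Function.Injective φ) (h : MeetProperly p s s') : MeetProperly (φ ∘ p) s s' := by
  simpa only [MeetProperly, image_comp, ← φ.image_convexHull, ← image_inter hφ] using
    image_mono h

end MeetProperly

namespace TriangleDrawing

section

variable {V E : Type*} [AddCommGroup E] [Module ℝ E] {G : SimpleGraph V} {t : Fin 3 → V}
  {p : V → E}

theorem mem_of_mem_convexHull (D : TriangleDrawing G t p) {v : V} {s : Set V} (hs : IsCell G t s)
    (hv : p v ∈ convexHull ℝ (p '' s)) : v ∈ s := by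
  have h := D.meetProperly (.vertex v) hs ⟨subset_convexHull ℝ _ (mem_image_of_mem p rfl), hv⟩
  obtain ⟨_, rfl, hvs⟩ := (convexHull_nonempty_iff.1 ⟨_, h⟩).of_image
  exact hvs

theorem injective (D : TriangleDrawing G t p) : Function.Injective p := fun u v huv => by
  simpa using D.mem_of_mem_convexHull (v := u) (.vertex v) (by simp [huv])

theorem map_iso (D : TriangleDrawing G t p) {W : Type*} {H : SimpleGraph W} (e : G ≃g H) :
    TriangleDrawing H (e ∘ t) (p ∘ e.symm) where
  affineIndependent := by
    convert D.affineIndependent using 1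
    ext i
    simp
  meetProperly := by
    have hcell : ∀ {s}, IsCell H (e ∘ t) s → IsCell G t (e.symm '' s) := by
      rintro _ (v | he | _)
      · simpa using IsCell.vertex (e.symm v)
      · simpa only [← Sym2.coe_map] using IsCell.edge (t := t) (e.symm.map_mem_edgeSet_iff.2 he)
      · simpa [← range_comp, Function.comp_def] using IsCell.triangle
    intro s s' hs hs'
    simpa only [MeetProperly, image_comp, image_inter e.symm.injective] using
      D.meetProperly (hcell hs) (hcell hs')

theorem affineMap_comp {F : Type*} [AddCommGroup F] [Module ℝ F] (D : TriangleDrawing G t p)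
    {φ : E →ᵃ[ℝ] F} (hφ : Function.Injective φ) : TriangleDrawing G t (φ ∘ p) where
  affineIndependent := D.affineIndependent.map' φ hφ
  meetProperly hs hs' := (D.meetProperly hs hs').affineMap_comp hφ

end

variable {V : Type*} {G : SimpleGraph V} {t : Fin 3 → V} {p : V → ℝ × ℝ}

/-- The segments between adjacent points form a crossing-free drawing. -/
def toPlaneDrawing (D : TriangleDrawing G t p) : PlaneDrawing G where
  point := p
  arc e := convexHull ℝ (p '' e)
  point_injective := D.injective
  arc_simple u v huv := ⟨.segment (p u) (p v),
    Path.segment_injective_of_ne (D.injective.ne huv.ne), by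
      rw [Path.range_segment, Sym2.coe_mk, image_pair, convexHull_pair]⟩
  mem_of_point_mem_arc := by
    rintro ⟨u, v⟩ he w hw
    simpa using D.mem_of_mem_convexHull (.edge he) (by simpa using hw)
  arc_inter_arc := by
    intro e he f hf hef
    have hsub : ((e : Set V) ∩ f).Subsingleton := fun u hu v hv => by_contra fun huv =>
      hef (((Sym2.mem_and_mem_iff huv).1 ⟨hu.1, hv.1⟩).trans
        ((Sym2.mem_and_mem_iff huv).1 ⟨hu.2, hv.2⟩).symm)
    refine (D.meetProperly (.edge he) (.edge hf)).trans ?_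
    rw [(hsub.image p).convex.convexHull_eq]
    exact image_subset_range p _

/-- The open triangle spanned by the points of the triangle. -/
def face (p : V → ℝ × ℝ) (t : Fin 3 → V) : Set (ℝ × ℝ) :=
  interior (convexHull ℝ (p '' range t))

theorem frontier_face (D : TriangleDrawing G t p) :
    frontier (face p t) = ⋃ i, convexHull ℝ (p '' (t '' {i}ᶜ)) := by
  have hcoe : ⇑(planeAffineBasis D.affineIndependent) = p ∘ t := rfl
  simpa only [face, hcoe, range_comp, image_comp] using
    frontier_convexHull_range_affineBasis (planeAffineBasis D.affineIndependent)

theorem disjoint_face (D : TriangleDrawing G t p) {s : Set V} (hs : IsCell G t s) {i : Fin 3}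
    (hi : t i ∉ s) : Disjoint (convexHull ℝ (p '' s)) (face p t) := by
  refine Set.disjoint_left.2 fun q hq hqF => ?_
  have hside : s ∩ range t ⊆ t '' {i}ᶜ := by
    rintro _ ⟨hj, j, rfl⟩
    exact mem_image_of_mem t fun hji => hi (mem_singleton_iff.1 hji ▸ hj)
  have hfr : q ∈ frontier (face p t) := D.frontier_face ▸ mem_iUnion.2
    ⟨i, convexHull_mono (image_mono hside)
      (D.meetProperly hs .triangle ⟨hq, interior_subset hqF⟩)⟩
  exact isOpen_interior.inter_frontier_eq.subset ⟨hqF, hfr⟩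

theorem disjoint_carrier_face (D : TriangleDrawing G t p) :
    Disjoint D.toPlaneDrawing.carrier (face p t) := by
  have hinj : Function.Injective t := .of_comp D.affineIndependent.injective
  have hpair : ∀ u v, ∃ i, t i ∉ ({u, v} : Set V) := fun u v => by
    by_contra! h
    have hle := (encard_le_encard (range_subset_iff.2 h)).trans (encard_insert_le {v} u)
    norm_num [← image_univ, hinj.encard_image, encard_univ] at hle
  rw [PlaneDrawing.carrier, disjoint_union_left, disjoint_iUnion₂_left]
  constructor
  · rw [Set.disjoint_left]
    rintro _ ⟨v, rfl⟩
    obtain ⟨i, hi⟩ := hpair v v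
    exact Set.disjoint_left.1 (D.disjoint_face (.vertex v) (by simpa using hi))
      (subset_convexHull ℝ _ (mem_image_of_mem p rfl))
  · rintro ⟨u, v⟩ he
    obtain ⟨i, hi⟩ := hpair u v
    exact D.disjoint_face (.edge he) (by simpa using hi)

theorem isFacialTriangle (D : TriangleDrawing G t p) (ht : ∀ i, G.Adj (t i) (t (i + 1))) :
    D.toPlaneDrawing.IsFacialTriangle t := by
  have hsides : frontier (face p t) = ⋃ i, D.toPlaneDrawing.arc s(t i, t (i + 1)) := by
    have hcompl : ∀ i : Fin 3, ({i + 2}ᶜ : Set (Fin 3)) = {i, i + 1} := by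
      intro i
      ext j
      fin_cases i <;> fin_cases j <;> simp
    rw [D.frontier_face, ← (Equiv.addRight (2 : Fin 3)).surjective.iUnion_comp]
    simp [hcompl, image_pair, toPlaneDrawing]
  have hcarrier : frontier (face p t) ⊆ D.toPlaneDrawing.carrier :=
    hsides.subset.trans <| iUnion_subset fun i =>
      (subset_biUnion_of_mem (G.mem_edgeSet.2 (ht i))).trans subset_union_right
  obtain ⟨x, hx⟩ : (face p t).Nonempty :=
    ⟨_, range_comp p t ▸ (planeAffineBasis D.affineIndependent).centroid_mem_interior_convexHull⟩
  refine ⟨ht, face p t, ⟨_, ?_, (connectedComponentIn_eq_of_disjoint_frontier isOpen_interior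
    (convex_convexHull ℝ _).interior.isPreconnected ?_ ?_ hx).symm⟩, hsides⟩
  · exact fun h => Set.disjoint_left.1 D.disjoint_carrier_face h hx
  · exact D.disjoint_carrier_face.subset_compl_left
  · exact disjoint_compl_left.mono_right hcarrier

end TriangleDrawing

/-- Twice the signed area of the triangle `a b c`. -/
def orient {R : Type*} [CommRing R] (a b c : R × R) : R :=
  (b.1 - a.1) * (c.2 - a.2) - (b.2 - a.2) * (c.1 - a.1)

theorem exists_affineMap_eq_orient (a b : ℝ × ℝ) :
    ∃ f : ℝ × ℝ →ᵃ[ℝ] ℝ, ∀ c, f c = orient a b c := by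
  let l : ℝ × ℝ →ₗ[ℝ] ℝ :=
    (b.1 - a.1) • LinearMap.snd ℝ ℝ ℝ - (b.2 - a.2) • LinearMap.fst ℝ ℝ ℝ
  refine ⟨l.toAffineMap - AffineMap.const ℝ _ (l a), fun c => ?_⟩
  simp [l, orient]
  ring

theorem affineIndependent_of_orient_ne_zero {q : Fin 3 → ℝ × ℝ}
    (h : orient (q 0) (q 1) (q 2) ≠ 0) : AffineIndependent ℝ q := by
  rw [affineIndependent_iff_not_collinear, collinear_iff_exists_forall_eq_smul_vadd]
  rintro ⟨a, v, hq⟩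
  obtain ⟨⟨r₀, h₀⟩, ⟨r₁, h₁⟩, r₂, h₂⟩ :=
    (⟨hq _ ⟨0, rfl⟩, hq _ ⟨1, rfl⟩, hq _ ⟨2, rfl⟩⟩ : _ ∧ _ ∧ _)
  refine h ?_
  rw [h₀, h₁, h₂]
  simp [orient]
  ring

/-- A lattice point as a point of the plane. -/
def latticePoint (a : ℤ × ℤ) : ℝ × ℝ := (a.1, a.2)

theorem latticePoint_injective : Function.Injective latticePoint := fun a b h => by
  simpa [latticePoint, Prod.ext_iff] using h

theorem orient_latticePoint (a b c : ℤ × ℤ) :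
    orient (latticePoint a) (latticePoint b) (latticePoint c) = (orient a b c : ℤ) := by
  simp [orient, latticePoint]

section Certificate

variable {V : Type*} {G : SimpleGraph V} {t : Fin 3 → V} {P : V → ℤ × ℤ}

/-- The triangle `t` and the edges at the vertices in `vs`, with neighbors given by `N`, as finite
sets of vertices. -/
def cellList [DecidableEq V] (N : V → List V) (vs : List V) (t : Fin 3 → V) : List (Finset V) :=
  Finset.univ.image t :: (vs.flatMap fun v => (N v).map fun w => {v, w}).dedup

/-- Some line through points of `s'` separates `s` from `s'` and touches `s` only in common points.
The degenerate line through a point and itself covers the case `s ⊆ s'`. -/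
def Separated (P : V → ℤ × ℤ) (s s' : Finset V) : Prop :=
  ∃ a ∈ s', ∃ b ∈ s', (∀ v ∈ s, orient (P a) (P b) (P v) ≤ 0 ∧
    (orient (P a) (P b) (P v) = 0 → v ∈ s')) ∧ ∀ v ∈ s', 0 ≤ orient (P a) (P b) (P v)

instance [DecidableEq V] (P : V → ℤ × ℤ) (s s' : Finset V) : Decidable (Separated P s s') := by
  unfold Separated
  infer_instance

theorem Separated.meetProperly {s s' : Finset V} (h : Separated P s s')
    (hP : Function.Injective P) : MeetProperly (latticePoint ∘ P) s s' := by
  obtain ⟨a, -, b, -, hs, hs'⟩ := h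
  obtain ⟨f, hf⟩ := exists_affineMap_eq_orient (latticePoint (P a)) (latticePoint (P b))
  have hfP : ∀ v, f ((latticePoint ∘ P) v) = orient (P a) (P b) (P v) := fun v => by
    rw [hf, Function.comp_apply, orient_latticePoint]
  rw [MeetProperly, image_inter (latticePoint_injective.comp hP)]
  refine convexHull_inter_subset_of_separated (f := f) ?_ ?_
  · rintro _ ⟨v, hv, rfl⟩
    rw [hfP]
    exact ⟨mod_cast (hs v hv).1, fun h => mem_image_of_mem _ ((hs v hv).2 (mod_cast h))⟩
  · rintro _ ⟨v, hv, rfl⟩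
    rw [hfP]
    exact mod_cast hs' v hv

variable [DecidableEq V] {N : V → List V} {vs : List V}

theorem IsCell.exists_eq_singleton_or_mem_cellList (hN : ∀ v w, G.Adj v w ↔ w ∈ N v)
    (hvs : ∀ v, v ∈ vs) {s : Set V} (hs : IsCell G t s) :
    (∃ v, s = {v}) ∨ ∃ c ∈ cellList N vs t, s = c := by
  cases hs with
  | vertex v => exact .inl ⟨v, rfl⟩
  | @edge e he =>
    induction e with | _ v w
    have hw : w ∈ N v := (hN v w).1 he
    refine .inr ⟨{v, w}, .tail _ (List.mem_dedup.2 (List.mem_flatMap.2 ⟨v, hvs v, ?_⟩)), by simp⟩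
    exact List.mem_map_of_mem hw
  | triangle => exact .inr ⟨_, .head _, by simp⟩

theorem TriangleDrawing.of_separated (hN : ∀ v w, G.Adj v w ↔ w ∈ N v) (hvs : ∀ v, v ∈ vs)
    (hP : Function.Injective P) (ht : orient (P (t 0)) (P (t 1)) (P (t 2)) ≠ 0)
    (hvertex : ∀ v, (cellList N vs t).all (Separated P {v} ·))
    (hcell : (cellList N vs t).Pairwise fun c c' => Separated P c c' ∨ Separated P c' c) :
    TriangleDrawing G t (latticePoint ∘ P) where
  affineIndependent := affineIndependent_of_orient_ne_zero <| by
    simpa only [Function.comp_apply, orient_latticePoint] using Int.cast_ne_zero.2 ht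
  meetProperly := by
    have hv : ∀ v, ∀ c ∈ cellList N vs t, MeetProperly (latticePoint ∘ P) {v} c :=
      fun v c hc => by
        simpa using (of_decide_eq_true (List.all_eq_true.1 (hvertex v) c hc)).meetProperly hP
    have hcc' : ∀ c ∈ cellList N vs t, ∀ c' ∈ cellList N vs t,
        MeetProperly (latticePoint ∘ P) c c' := fun c hc c' hc' => by
      rcases eq_or_ne c c' with rfl | hne
      · exact .self _
      · have : Std.Symm fun c c' : Finset V => Separated P c c' ∨ Separated P c' c :=
          ⟨fun _ _ h => h.symm⟩
        exact (hcell.forall hc hc' hne).elim (·.meetProperly hP) (·.meetProperly hP |>.symm)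
    intro s s' hs hs'
    rcases hs.exists_eq_singleton_or_mem_cellList hN hvs with ⟨v, rfl⟩ | ⟨c, hc, rfl⟩ <;>
      rcases hs'.exists_eq_singleton_or_mem_cellList hN hvs with ⟨v', rfl⟩ | ⟨c', hc', rfl⟩
    · rw [MeetProperly, image_inter (latticePoint_injective.comp hP)]
      simp [subset_convexHull]
    · exact hv v c' hc'
    · exact (hv v' c hc).symm
    · exact hcc' c hc c' hc'

end Certificate

section Crown

/-- The triangle `z 0, z 1, z 2` inside a crowning, where the next crowning takes place. -/
def crownTriangle (V : Type*) (i : Fin 3) : CrownVertex V := .inr (.inr (.inr i))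

/-- The gadget inserted by a crowning: the crowning of a single triangle, whose sides disappear.
Its vertices `.inl i` are called corners. -/
abbrev gadget : SimpleGraph (CrownVertex (Fin 3)) := (⊤ : SimpleGraph (Fin 3)).crown id

/-- The embedding of the gadget into the crowning at the triangle `t`. -/
abbrev ofGadget {V : Type*} (t : Fin 3 → V) : CrownVertex (Fin 3) → CrownVertex V := Sum.map t id

/-- The vertices of the gadget that are not corners. -/
def gadgetInnerVertices : List (CrownVertex (Fin 3)) :=
  (List.finRange 3).flatMap fun i => [.inr (.inl i), .inr (.inr (.inl i)), .inr (.inr (.inr i))]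

/-- The vertices of the gadget. -/
def gadgetVertices : List (CrownVertex (Fin 3)) :=
  (List.finRange 3).map .inl ++ gadgetInnerVertices

theorem inr_mem_gadgetInnerVertices (r : Fin 3 ⊕ Fin 3 ⊕ Fin 3) :
    .inr r ∈ gadgetInnerVertices := by
  rcases r with i | i | i <;> simp [gadgetInnerVertices]

theorem mem_gadgetVertices (v : CrownVertex (Fin 3)) : v ∈ gadgetVertices := by
  rcases v with i | r
  · simp [gadgetVertices]
  · exact List.mem_append_right _ (inr_mem_gadgetInnerVertices r)

/-- The neighbors of the vertices of the gadget. -/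
def gadgetNeighbors : CrownVertex (Fin 3) → List (CrownVertex (Fin 3))
  | .inl i => [.inr (.inl i), .inr (.inr (.inl (i + 2)))]
  | .inr (.inl i) =>
    [.inl i, .inr (.inr (.inl i)), .inr (.inr (.inl (i + 2))), .inr (.inr (.inr i))]
  | .inr (.inr (.inl i)) =>
    [.inl (i + 1), .inr (.inl i), .inr (.inl (i + 1)), .inr (.inr (.inr i))]
  | .inr (.inr (.inr i)) =>
    [.inr (.inl i), .inr (.inr (.inl i)), .inr (.inr (.inr (i + 1))), .inr (.inr (.inr (i + 2)))]

theorem gadget_adj_iff (v w : CrownVertex (Fin 3)) : gadget.Adj v w ↔ w ∈ gadgetNeighbors v := by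
  rcases v with i | i | i | i <;> rcases w with j | j | j | j <;>
    simp only [crown, crownRel, gadgetNeighbors, fromRel_adj, top_adj, List.mem_cons,
      List.not_mem_nil, ne_eq, reduceCtorEq, Sum.inl.injEq, Sum.inr.injEq, id_eq, exists_eq'] <;>
    decide +revert

variable {V : Type*} {G : SimpleGraph V} {t : Fin 3 → V}

theorem crown_adj_iff {a b : CrownVertex V} :
    (G.crown t).Adj a b ↔
      (∃ u v, G.Adj u v ∧ ¬ (u ∈ range t ∧ v ∈ range t) ∧ a = .inl u ∧ b = .inl v) ∨
      ∃ w w', gadget.Adj w w' ∧ a = ofGadget t w ∧ b = ofGadget t w' := by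
  rcases a with u | i | i | i <;> rcases b with v | j | j | j <;>
    simp [crown, crownRel]
  grind [G.ne_of_adj, G.adj_comm]

theorem ofGadget_injective (ht : Function.Injective t) : Function.Injective (ofGadget t) :=
  ht.sumMap Function.injective_id

theorem IsCell.of_crown {s : Set (CrownVertex V)} (hs : IsCell (G.crown t) (crownTriangle V) s) :
    (∃ s₀, IsCell G t s₀ ∧ (s₀ ∩ range t).Subsingleton ∧ s = .inl '' s₀) ∨
      ∃ s₀, IsCell gadget (crownTriangle (Fin 3)) s₀ ∧ s = ofGadget t '' s₀ := by
  cases hs with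
  | vertex a =>
    rcases a with v | r
    · exact .inl ⟨{v}, .vertex v, subsingleton_singleton.anti inter_subset_left, by simp⟩
    · exact .inr ⟨{.inr r}, .vertex _, by simp⟩
  | @edge e he =>
    induction e with | _ a b
    rcases crown_adj_iff.1 he with ⟨u, v, huv, hside, rfl, rfl⟩ | ⟨w, w', h, rfl, rfl⟩
    · refine .inl ⟨_, .edge (e := s(u, v)) huv, ?_, by simp [image_pair]⟩
      rintro a ⟨ha, hat⟩ b ⟨hb, hbt⟩
      by_contra hab
      aesop
    · exact .inr ⟨_, .edge (e := s(w, w')) h, by simp [image_pair]⟩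
  | triangle => exact .inr ⟨_, .triangle, by rw [← range_comp]; rfl⟩

/-- Barycentric coordinates, multiplied by `8`, of the vertices of the gadget with respect to its
corners. They are invariant under rotation of the gadget, so they depend on `j - i` only. -/
def gadgetWeight : CrownVertex (Fin 3) → Fin 3 → ℤ
  | .inl i, j => ![8, 0, 0] (j - i)
  | .inr (.inl i), j => ![5, 2, 1] (j - i)
  | .inr (.inr (.inl i)), j => ![2, 5, 1] (j - i)
  | .inr (.inr (.inr i)), j => ![3, 3, 2] (j - i)

/-- A drawing of the gadget inside the triangle spanned by its corners `(8, 0)`, `(0, 8)` and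
`(-8, -8)`. -/
def gadgetPoint (w : CrownVertex (Fin 3)) : ℤ × ℤ :=
  (gadgetWeight w 0 - gadgetWeight w 2, gadgetWeight w 1 - gadgetWeight w 2)

theorem triangleDrawing_gadget :
    TriangleDrawing gadget (crownTriangle (Fin 3)) (latticePoint ∘ gadgetPoint) :=
  .of_separated gadget_adj_iff mem_gadgetVertices (by decide +kernel) (by decide +kernel)
    (by decide +kernel) (by decide +kernel)

theorem affineIndependent_corners :
    AffineIndependent ℝ (latticePoint ∘ gadgetPoint ∘ (.inl : Fin 3 → CrownVertex (Fin 3))) :=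
  affineIndependent_of_orient_ne_zero <| by
    simpa only [Function.comp_apply, orient_latticePoint] using
      Int.cast_ne_zero.2 (by decide +kernel)

theorem gadgetPoint_mem_convexHull_corners (w : CrownVertex (Fin 3)) :
    latticePoint (gadgetPoint w) ∈
      convexHull ℝ (range (latticePoint ∘ gadgetPoint ∘ .inl)) := by
  have hnonneg : ∀ j, 0 ≤ gadgetWeight w j := by
    rcases w with i | i | i | i <;> decide +revert
  have hsum : ∑ j, gadgetWeight w j = 8 := by rcases w with i | i | i | i <;> decide +revert
  have hcomb : ∑ j, ((gadgetWeight w j : ℝ) / 8) • latticePoint (gadgetPoint (.inl j)) =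
      latticePoint (gadgetPoint w) := by
    ext <;> simp [Fin.sum_univ_three, latticePoint, gadgetPoint, gadgetWeight] <;> ring
  rw [← hcomb]
  refine (convex_convexHull ℝ _).sum_mem (fun j _ => div_nonneg (mod_cast hnonneg j) (by simp)) ?_
    fun j _ => subset_convexHull ℝ _ (mem_range_self j)
  rw [← Finset.sum_div, ← Int.cast_sum, hsum]
  norm_num

theorem IsCell.meetProperly_gadget {E : Type*} [AddCommGroup E] [Module ℝ E]
    {q : CrownVertex V → E} (D : TriangleDrawing G t (q ∘ .inl))
    (hgadget : TriangleDrawing gadget (crownTriangle (Fin 3)) (q ∘ ofGadget t))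
    (hhull : ∀ w, q (ofGadget t w) ∈ convexHull ℝ (range (q ∘ .inl ∘ t)))
    {s : Set V} {s' : Set (CrownVertex (Fin 3))} (hs : IsCell G t s)
    (hst : (s ∩ range t).Subsingleton)
    (hs' : IsCell gadget (crownTriangle (Fin 3)) s') :
    MeetProperly q (.inl '' s) (ofGadget t '' s') := by
  rintro r ⟨hr, hr'⟩
  have hrt : r ∈ convexHull ℝ ((q ∘ .inl) '' (s ∩ range t)) := by
    refine D.meetProperly hs .triangle ⟨by rwa [image_comp], ?_⟩
    refine convexHull_min ?_ (convex_convexHull ℝ _) hr'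
    rintro _ ⟨_, ⟨w, -, rfl⟩, rfl⟩
    exact range_comp (q ∘ .inl) t ▸ hhull w
  rw [(hst.image _).convex.convexHull_eq] at hrt
  obtain ⟨_, ⟨hts, i, rfl⟩, rfl⟩ := hrt
  have hi : .inl i ∈ s' := hgadget.mem_of_mem_convexHull hs' (by rwa [image_comp])
  exact subset_convexHull ℝ _ (mem_image_of_mem q ⟨mem_image_of_mem _ hts, mem_image_of_mem _ hi⟩)

theorem TriangleDrawing.crown {E : Type*} [AddCommGroup E] [Module ℝ E] {q : CrownVertex V → E}
    (D : TriangleDrawing G t (q ∘ .inl))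
    (hgadget : TriangleDrawing gadget (crownTriangle (Fin 3)) (q ∘ ofGadget t))
    (hhull : ∀ w, q (ofGadget t w) ∈ convexHull ℝ (range (q ∘ .inl ∘ t))) :
    TriangleDrawing (G.crown t) (crownTriangle V) q where
  affineIndependent := hgadget.affineIndependent
  meetProperly {s s'} hs hs' := by
    rcases hs.of_crown with ⟨s₀, hs₀, ht, rfl⟩ | ⟨s₀, hs₀, rfl⟩ <;>
      rcases hs'.of_crown with ⟨s₁, hs₁, ht', rfl⟩ | ⟨s₁, hs₁, rfl⟩
    · exact (D.meetProperly hs₀ hs₁).image Sum.inl_injective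
    · exact hs₀.meetProperly_gadget D hgadget hhull ht hs₁
    · exact (hs₁.meetProperly_gadget D hgadget hhull ht' hs₀).symm
    · exact (hgadget.meetProperly hs₀ hs₁).image
        (ofGadget_injective (.of_comp D.affineIndependent.injective))

theorem TriangleDrawing.exists_crown {E : Type*} [AddCommGroup E] [Module ℝ E] {p : V → E}
    (D : TriangleDrawing G t p) :
    ∃ q : CrownVertex V → E, TriangleDrawing (G.crown t) (crownTriangle V) q := by
  obtain ⟨φ, hφ, hφt⟩ :=
    exists_injective_affineMap (planeAffineBasis affineIndependent_corners) D.affineIndependent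
  let gadgetMap := φ ∘ latticePoint ∘ gadgetPoint
  have hcorner : ∀ i, gadgetMap (.inl i) = p (t i) := hφt
  let q : CrownVertex V → E := Sum.elim p (gadgetMap ∘ .inr)
  have hq : q ∘ ofGadget t = gadgetMap := by
    ext (i | r)
    exacts [(hcorner i).symm, rfl]
  refine ⟨q, .crown D (hq ▸ triangleDrawing_gadget.affineMap_comp hφ) fun w => ?_⟩
  have hqt : q ∘ .inl ∘ t = φ ∘ latticePoint ∘ gadgetPoint ∘ .inl :=
    funext fun i => (hcorner i).symm
  rw [hqt, range_comp φ, ← φ.image_convexHull, ← Function.comp_apply (f := q), hq]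
  exact mem_image_of_mem φ (gadgetPoint_mem_convexHull_corners w)

end Crown

section Coloring

variable {V W : Type*} {G : SimpleGraph V} {H : SimpleGraph W} {k : ℕ}

theorem colorable_succ_of_deleteEdges_singleton {e : Sym2 V}
    (h : (G.deleteEdges {e}).Colorable k) : G.Colorable (k + 1) := by
  classical
  obtain ⟨C⟩ := h
  induction e with | _ a b
  refine ⟨Coloring.mk (fun v => if v = a then Fin.last k else (C v).castSucc) fun {u v} huv => ?_⟩
  have huv' := huv.ne
  have hC : u ≠ a → v ≠ a → C u ≠ C v := fun hu hv =>
    C.valid <| deleteEdges_adj.2 ⟨huv, by simp [hu, hv]⟩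
  grind [Fin.castSucc_ne_last, Fin.castSucc_inj]

theorem isEdgeCritical_succ_iff_of_adj {u v : V} (huv : G.Adj u v) :
    G.IsEdgeCritical (k + 1) ↔
      ¬ G.Colorable k ∧ ∀ e ∈ G.edgeSet, (G.deleteEdges {e}).Colorable k := by
  have hlt : ∀ H : SimpleGraph V, H.chromaticNumber < (k + 1 : ℕ) ↔ H.Colorable k := fun H => by
    rw [← chromaticNumber_le_iff_colorable, Nat.cast_add_one, ENat.lt_add_one_iff (by simp)]
  constructor
  · rintro ⟨hχ, hdel⟩
    simp only [hχ, hlt] at hdel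
    exact ⟨by simp [← hlt, hχ], hdel⟩
  · rintro ⟨hG, hdel⟩
    have hχ : G.chromaticNumber = (k + 1 : ℕ) := by
      rw [Nat.cast_add_one, chromaticNumber_eq_iff_colorable_not_colorable]
      exact ⟨colorable_succ_of_deleteEdges_singleton (hdel s(u, v) huv), hG⟩
    exact ⟨hχ, by simpa only [hχ, hlt] using hdel⟩

theorem isEdgeCritical_of_iso (e : G ≃g H) {n : ℕ} (hG : G.IsEdgeCritical n) :
    H.IsEdgeCritical n := by
  have hχ := chromaticNumber_congr e
  refine ⟨hχ.symm.trans hG.1, fun d hd => ?_⟩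
  let deletionHom : H.deleteEdges {d} →g G.deleteEdges {d.map e.symm} :=
    { toFun := e.symm
      map_rel' {a b} hab := by
        obtain ⟨hab, hne⟩ := deleteEdges_adj.1 hab
        exact deleteEdges_adj.2
          ⟨e.symm.map_adj_iff.2 hab, (Sym2.map.injective e.symm.injective).ne hne⟩ }
  calc (H.deleteEdges {d}).chromaticNumber ≤ (G.deleteEdges {d.map e.symm}).chromaticNumber :=
        chromaticNumber_mono_of_hom deletionHom
    _ < G.chromaticNumber := hG.2 _ (e.symm.toHom.map_mem_edgeSet hd)
    _ = H.chromaticNumber := hχ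

end Coloring

section FoldColoring

variable {V W : Type*} {G : SimpleGraph V} {H : SimpleGraph W} {b m n : ℕ}

theorem isFoldColoring_comp_hom {c : V → Finset (Fin m)} (hc : G.IsFoldColoring b m c)
    (f : H →g G) : H.IsFoldColoring b m (c ∘ f) :=
  ⟨fun _ => hc.1 _, fun _ _ huv => hc.2 _ _ (f.map_adj huv)⟩

theorem card_mul_le_of_isFoldColoring_top {ι : Type*} [Fintype ι] {c : ι → Finset (Fin m)}
    (hc : (⊤ : SimpleGraph ι).IsFoldColoring b m c) : Fintype.card ι * b ≤ m := by
  have hcard : (Finset.univ.biUnion c).card = ∑ i, (c i).card :=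
    Finset.card_biUnion fun i _ j _ hij => hc.2 i j hij
  simpa [hcard, hc.1] using (Finset.univ.biUnion c).card_le_univ

theorem exists_isFoldColoring_of_colorable (h : G.Colorable n) (b : ℕ) :
    ∃ c, G.IsFoldColoring b (n * b) c := by
  obtain ⟨C⟩ := h
  let pairs : V → Fin b ↪ Fin (n * b) := fun v =>
    (Function.Embedding.sectR (C v) (Fin b)).trans finProdFinEquiv.toEmbedding
  refine ⟨fun v => Finset.univ.map (pairs v), fun v => by simp, fun u v huv => ?_⟩
  rw [Finset.disjoint_left]
  rintro _ hu hv
  obtain ⟨i, -, rfl⟩ := Finset.mem_map.1 hu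
  obtain ⟨j, -, hij⟩ := Finset.mem_map.1 hv
  exact C.valid huv (Prod.ext_iff.1 (finProdFinEquiv.injective hij)).1.symm

theorem fractionalChromaticNumber_eq_card [Finite V] {ι : Type*} [Fintype ι]
    (f : (⊤ : SimpleGraph ι) →g G) (hb : 0 < b)
    (hG : ∃ c, G.IsFoldColoring b (Fintype.card ι * b) c) :
    G.fractionalChromaticNumber = Fintype.card ι := by
  have := Fintype.ofFinite V
  refine le_antisymm ?_ (le_ciInf fun b' => ?_)
  · have hle : G.foldChromaticNumber b ≤ Fintype.card ι * b := Nat.sInf_le hG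
    refine (ciInf_le ⟨0, ?_⟩ (⟨b, hb⟩ : ℕ+)).trans ?_
    · rintro _ ⟨b', rfl⟩
      positivity
    · rw [div_le_iff₀ (mod_cast hb)]
      exact mod_cast hle
  · rw [le_div_iff₀ (mod_cast b'.pos)]
    obtain ⟨c, hc⟩ : ∃ c, G.IsFoldColoring b' (G.foldChromaticNumber b') c := Nat.sInf_mem
      (s := {m | ∃ c : V → Finset (Fin m), G.IsFoldColoring b' m c})
      ⟨_, exists_isFoldColoring_of_colorable G.colorable_of_fintype b'⟩
    exact mod_cast card_mul_le_of_isFoldColoring_top (isFoldColoring_comp_hom hc f)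

end FoldColoring

section Search

variable {V : Type*} [DecidableEq V] {G : SimpleGraph V} {N : V → List V} {k : ℕ}

/-- Backtracking search for proper `k`-colorings: the vertices in the list are colored one by one,
subject to the constraints given by the neighbor lists `N`; the other vertices have the color given
by the function. -/
def searchColoring (N : V → List V) : List V → (V → Fin k) → Bool
  | [], _ => true
  | v :: vs, c => (List.finRange k).any fun a =>
      (N v).all (fun w => w ∈ vs ∨ c w ≠ a) && searchColoring N vs (Function.update c v a)

theorem searchColoring_eq_true_iff (hN : ∀ v w, G.Adj v w ↔ w ∈ N v) {vs : List V}
    {c : V → Fin k} : searchColoring N vs c = true ↔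
      ∃ C : V → Fin k, (∀ v ∉ vs, C v = c v) ∧ ∀ v ∈ vs, ∀ w, G.Adj v w → C v ≠ C w := by
  induction vs generalizing c with
  | nil => simpa [searchColoring] using ⟨c, fun _ => rfl⟩
  | cons v vs ih =>
    simp only [searchColoring, List.any_eq_true, List.mem_finRange, true_and, Bool.and_eq_true,
      List.all_eq_true, decide_eq_true_eq, ih, ← hN]
    constructor
    · rintro ⟨a, ha, C, hC, hproper⟩
      refine ⟨C, fun u hu => ?_, fun u hu w huw => ?_⟩
      · grind
      · have := huw.ne
        rcases List.mem_cons.1 hu with rfl | hu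
        · by_cases hw : w ∈ vs
          · exact (hproper w hw u huw.symm).symm
          · grind
        · exact hproper u hu w huw
    · rintro ⟨C, hC, hproper⟩
      refine ⟨C v, fun w hvw => ?_, C, fun u hu => ?_, fun u hu => hproper u (.tail _ hu)⟩
      · by_contra! h
        exact hproper v (.head _) w hvw ((hC w (by grind [hvw.ne])).trans h.2).symm
      · rcases eq_or_ne u v with rfl | huv
        · simp
        · grind

theorem searchColoring_eq_true_iff_exists_coloring (hN : ∀ v w, G.Adj v w ↔ w ∈ N v)
    {vs : List V} (hvs : ∀ v w, G.Adj v w → v ∈ vs ∨ w ∈ vs) {c : V → Fin k} :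
    searchColoring N vs c = true ↔ ∃ C : G.Coloring (Fin k), ∀ v ∉ vs, C v = c v := by
  rw [searchColoring_eq_true_iff hN]
  constructor
  · rintro ⟨C, hC, hproper⟩
    refine ⟨Coloring.mk C fun {v w} hvw => ?_, hC⟩
    exact (hvs v w hvw).elim (hproper v · w hvw) (hproper w · v hvw.symm |>.symm)
  · rintro ⟨C, hC⟩
    exact ⟨C, hC, fun v _ w hvw => C.valid hvw⟩

theorem searchColoring_eq_true_iff_colorable (hN : ∀ v w, G.Adj v w ↔ w ∈ N v) {vs : List V}
    (hvs : ∀ v, v ∈ vs) (c : V → Fin k) : searchColoring N vs c = true ↔ G.Colorable k := by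
  rw [searchColoring_eq_true_iff_exists_coloring hN fun v _ _ => .inl (hvs v)]
  exact ⟨fun ⟨C, _⟩ => ⟨C⟩, fun ⟨C⟩ => ⟨C, fun v hv => absurd (hvs v) hv⟩⟩

theorem encard_neighborSet_eq_card_toFinset (hN : ∀ v w, G.Adj v w ↔ w ∈ N v) (v : V) :
    (G.neighborSet v).encard = (N v).toFinset.card := by
  rw [← encard_coe_eq_coe_finsetCard]
  congr 1
  ext w
  simp [hN]

theorem deleteEdges_adj_iff_mem_filter (hN : ∀ v w, G.Adj v w ↔ w ∈ N v) (e : Sym2 V) (v w : V) :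
    (G.deleteEdges {e}).Adj v w ↔ w ∈ (N v).filter (s(v, ·) ≠ e) := by
  simp [hN]

end Search

section BaseGraph

/-- The neighbors of the vertices of `baseGraph`. -/
def baseNeighbors : Fin 18 → List (Fin 18) :=
  ![[1, 2, 3, 4], [0, 3, 5, 9], [0, 3, 4, 13], [0, 1, 2, 7], [0, 2, 5, 8], [1, 4, 6, 11],
    [5, 9, 11, 17], [3, 9, 10, 15], [4, 11, 13, 16], [1, 6, 7, 15], [7, 12, 15, 17],
    [5, 6, 8, 14], [10, 13, 14, 16], [2, 8, 12, 16], [11, 12, 16, 17], [7, 9, 10, 17],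
    [8, 12, 13, 14], [6, 10, 14, 15]]

/-- The first graph of the sequence. -/
def baseGraph : SimpleGraph (Fin 18) where
  Adj v w := w ∈ baseNeighbors v
  symm := ⟨by decide⟩
  loopless := ⟨by decide⟩

/-- The triangle of `baseGraph` at which the first crowning takes place. -/
def baseTriangle : Fin 3 → Fin 18 := ![0, 1, 3]

/-- The vertices of a straight-line drawing of `baseGraph`. -/
def basePoint : Fin 18 → ℤ × ℤ :=
  ![(4, 0), (0, 4), (12, -4), (-4, -4), (8, 4), (4, 9), (2, 13), (-12, 12), (12, 11), (-4, 11),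
    (-4, 27), (6, 13), (12, 27), (20, 12), (8, 19), (-5, 17), (13, 17), (0, 19)]

/-- A 2-fold coloring of `baseGraph` with 6 colors. -/
def baseFoldColoring : Fin 18 → Finset (Fin 6) :=
  ![{1, 5}, {0, 2}, {0, 2}, {3, 4}, {3, 4}, {1, 5}, {0, 4}, {1, 2}, {0, 1}, {3, 5}, {3, 5}, {2, 3},
    {0, 1}, {4, 5}, {4, 5}, {0, 4}, {2, 3}, {1, 2}]

/-- The vertices of `baseGraph`, in an order for which `searchColoring` needs few steps. -/
def baseVertices : List (Fin 18) := [10, 15, 7, 9, 17, 6, 3, 1, 0, 2, 5, 4, 11, 14, 12, 16, 13, 8]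

theorem mem_baseVertices (v : Fin 18) : v ∈ baseVertices := by decide +revert

theorem baseGraph_adj_iff (v w : Fin 18) : baseGraph.Adj v w ↔ w ∈ baseNeighbors v := Iff.rfl

theorem baseGraph_adj_baseTriangle (i : Fin 3) :
    baseGraph.Adj (baseTriangle i) (baseTriangle (i + 1)) :=
  show baseTriangle (i + 1) ∈ baseNeighbors (baseTriangle i) by decide +revert

theorem encard_neighborSet_baseGraph (v : Fin 18) : (baseGraph.neighborSet v).encard = 4 := by
  have hcard : (baseNeighbors v).toFinset.card = 4 := by decide +revert
  rw [encard_neighborSet_eq_card_toFinset baseGraph_adj_iff, hcard, Nat.cast_ofNat]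

theorem isFoldColoring_baseGraph : baseGraph.IsFoldColoring 2 6 baseFoldColoring :=
  ⟨by decide +kernel,
    show ∀ v, ∀ w ∈ baseNeighbors v, Disjoint (baseFoldColoring v) (baseFoldColoring w) by
      decide +kernel⟩

theorem isEdgeCritical_baseGraph : baseGraph.IsEdgeCritical 4 := by
  refine (isEdgeCritical_succ_iff_of_adj (baseGraph_adj_baseTriangle 0)).2 ⟨?_, fun e he => ?_⟩
  · rw [← searchColoring_eq_true_iff_colorable baseGraph_adj_iff mem_baseVertices fun _ => 0]
    decide +kernel
  · rw [← searchColoring_eq_true_iff_colorable (deleteEdges_adj_iff_mem_filter baseGraph_adj_iff e)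
      mem_baseVertices fun _ => 0]
    induction e with | _ v w
    have hsearch : ∀ v, ∀ w ∈ baseNeighbors v, searchColoring (k := 3)
        (fun a => (baseNeighbors a).filter (s(a, ·) ≠ s(v, w))) baseVertices (fun _ => 0) := by
      decide +kernel
    exact hsearch v w he

theorem triangleDrawing_baseGraph :
    TriangleDrawing baseGraph baseTriangle (latticePoint ∘ basePoint) :=
  .of_separated baseGraph_adj_iff mem_baseVertices (by decide +kernel) (by decide +kernel)
    (by decide +kernel) (by decide +kernel)

end BaseGraph

section CrownColoring

variable {V : Type*} {G : SimpleGraph V} {t : Fin 3 → V}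

theorem adj_of_adj_succ (ht : ∀ i, G.Adj (t i) (t (i + 1))) {i j : Fin 3} (hij : i ≠ j) :
    G.Adj (t i) (t j) := by
  obtain rfl | rfl : j = i + 1 ∨ i = j + 1 := by decide +revert
  exacts [ht i, (ht j).symm]

/-- The homomorphism of a triangle given by its vertices. -/
def triangleHom (ht : ∀ i, G.Adj (t i) (t (i + 1))) : (⊤ : SimpleGraph (Fin 3)) →g G :=
  ⟨t, adj_of_adj_succ ht⟩

theorem injective_of_adj_succ (ht : ∀ i, G.Adj (t i) (t (i + 1))) : Function.Injective t :=
  (triangleHom ht).injective_of_top_hom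

/-- The map that fixes the old vertices and sends every new vertex to a vertex of the triangle. -/
def crownFold (t : Fin 3 → V) : CrownVertex V → V
  | .inl v => v
  | .inr (.inl i) => t (i + 1)
  | .inr (.inr (.inl i)) => t i
  | .inr (.inr (.inr i)) => t (i + 2)

theorem crownFold_ofGadget (t : Fin 3 → V) (w : CrownVertex (Fin 3)) :
    crownFold t (ofGadget t w) = t (crownFold id w) := by
  rcases w with i | i | i | i <;> rfl

/-- `crownFold` as a graph homomorphism. -/
def crownFoldHom (ht : ∀ i, G.Adj (t i) (t (i + 1))) : G.crown t →g G where
  toFun := crownFold t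
  map_rel' {a b} hab := by
    rcases crown_adj_iff.1 hab with ⟨u, v, huv, -, rfl, rfl⟩ | ⟨w, w', hw, rfl, rfl⟩
    · exact huv
    · have hne : ∀ w, ∀ w' ∈ gadgetNeighbors w, crownFold id w ≠ crownFold id w' := by
        decide +kernel
      simpa only [crownFold_ofGadget] using
        adj_of_adj_succ ht (hne w w' ((gadget_adj_iff w w').1 hw))

theorem corner_succ_ne_corner_add_two (C : gadget.Coloring (Fin 3)) (i : Fin 3) :
    C (.inl (i + 1)) ≠ C (.inl (i + 2)) := by
  let corner i := C (.inl i)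
  let x i := C (.inr (.inl i))
  let y i := C (.inr (.inr (.inl i)))
  let z i := C (.inr (.inr (.inr i)))
  have hadj : ∀ v, ∀ w ∈ gadgetNeighbors v, C v ≠ C w := fun v w hvw =>
    C.valid ((gadget_adj_iff v w).2 hvw)
  have hx_corner : ∀ i, x i ≠ corner i := fun i => hadj _ _ (by simp [gadgetNeighbors])
  have hy_corner : ∀ i, y i ≠ corner (i + 1) := fun i => hadj _ _ (by simp [gadgetNeighbors])
  have hxy : ∀ i, x i ≠ y i := fun i => hadj _ _ (by simp [gadgetNeighbors])
  have hyx : ∀ i, y i ≠ x (i + 1) := fun i => hadj _ _ (by simp [gadgetNeighbors])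
  have hzx : ∀ i, z i ≠ x i := fun i => hadj _ _ (by simp [gadgetNeighbors])
  have hzy : ∀ i, z i ≠ y i := fun i => hadj _ _ (by simp [gadgetNeighbors])
  have hzz : ∀ i, z i ≠ z (i + 1) := fun i => hadj _ _ (by simp [gadgetNeighbors])
  -- Equal colors at two corners force the colors of all inner vertices, up to a contradiction.
  intro h
  have hmod : ∀ i : Fin 3, i + 1 + 1 = i + 2 ∧ i + 2 + 1 = i := by decide
  have hz₁ : z (i + 1) = corner (i + 1) := by grind
  have hy₀ : y i = y (i + 1) := by grind
  have hx₂ : x (i + 2) = x (i + 1) := by grind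
  have hz₀ : z i = x (i + 1) := by grind
  have hz₂ : z (i + 2) = y (i + 1) := by grind
  have hx₀ : x i = corner (i + 1) := by grind
  have hy₂ : y (i + 2) = corner (i + 1) := by grind
  exact hyx (i + 2) (by rw [(hmod i).2, hx₀, hy₂])

theorem corner_ne_corner (C : gadget.Coloring (Fin 3)) {i j : Fin 3} (hij : i ≠ j) :
    C (.inl i) ≠ C (.inl j) := by
  obtain ⟨k, ⟨rfl, rfl⟩ | ⟨rfl, rfl⟩⟩ :
      ∃ k, i = k + 1 ∧ j = k + 2 ∨ j = k + 1 ∧ i = k + 2 := by decide +revert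
  exacts [corner_succ_ne_corner_add_two C k, (corner_succ_ne_corner_add_two C k).symm]

/-- `ofGadget` as a graph homomorphism. -/
def ofGadgetHom (G : SimpleGraph V) (t : Fin 3 → V) : gadget →g G.crown t :=
  ⟨ofGadget t, fun h => crown_adj_iff.2 (.inr ⟨_, _, h, rfl, rfl⟩)⟩

theorem colorable_three_of_crown (h : (G.crown t).Colorable 3) : G.Colorable 3 := by
  obtain ⟨C⟩ := h
  refine ⟨Coloring.mk (C ∘ .inl) fun {u v} huv => ?_⟩
  by_cases hside : u ∈ range t ∧ v ∈ range t
  · obtain ⟨⟨i, rfl⟩, j, rfl⟩ := hside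
    exact corner_ne_corner (C.comp (ofGadgetHom G t)) (ne_of_apply_ne t huv.ne)
  · exact C.valid (crown_adj_iff.2 (.inl ⟨u, v, huv, hside, rfl, rfl⟩))

theorem eq_of_coloring_deleteEdges {k : ℕ} (hG : ¬ G.Colorable k) {u v : V}
    (C : (G.deleteEdges {s(u, v)}).Coloring (Fin k)) : C u = C v := by
  by_contra hne
  refine hG ⟨Coloring.mk C fun {a b} hab => ?_⟩
  by_cases h : s(a, b) = s(u, v)
  · obtain ⟨rfl, rfl⟩ | ⟨rfl, rfl⟩ := Sym2.eq_iff.1 h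
    exacts [hne, Ne.symm hne]
  · exact C.valid (deleteEdges_adj.2 ⟨hab, h⟩)

theorem exists_coloring_deleteEdges_side (ht : ∀ i, G.Adj (t i) (t (i + 1)))
    (hG : ¬ G.Colorable 3) (j : Fin 3)
    (hdel : (G.deleteEdges {s(t (j + 1), t (j + 2))}).Colorable 3) :
    ∃ C : (G.deleteEdges {s(t (j + 1), t (j + 2))}).Coloring (Fin 3),
      ∀ i, C (t i) = if i = j then 1 else 0 := by
  obtain ⟨C⟩ := hdel
  have hsame : C (t (j + 1)) = C (t (j + 2)) := eq_of_coloring_deleteEdges hG C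
  have hside : ∀ j : Fin 3, s(j, j + 1) ≠ s(j + 1, j + 2) := by decide
  have hne : C (t j) ≠ C (t (j + 1)) := C.valid <| deleteEdges_adj.2
    ⟨ht j, (Sym2.map.injective (injective_of_adj_succ ht)).ne (hside j)⟩
  have hperm : ∀ a b : Fin 3, a ≠ b → ∃ σ : Equiv.Perm (Fin 3), σ a = 1 ∧ σ b = 0 := by decide
  obtain ⟨σ, hσ₁, hσ₀⟩ := hperm _ _ hne
  refine ⟨Coloring.mk (σ ∘ C) fun h => σ.injective.ne (C.valid h), fun i => ?_⟩
  change σ (C (t i)) = _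
  obtain rfl | rfl | rfl : i = j ∨ i = j + 1 ∨ i = j + 2 := by
    clear * -
    decide +revert
  all_goals simp [hσ₁, hσ₀, ← hsame]

theorem exists_coloring_gadget_deleteEdges {e : Sym2 (CrownVertex (Fin 3))}
    (he : e ∈ gadget.edgeSet) : ∃ j, ∃ C : (gadget.deleteEdges {e}).Coloring (Fin 3),
      ∀ i, C (.inl i) = if i = j then 1 else 0 := by
  induction e with | _ v w
  have hsearch : ∀ v, ∀ w ∈ gadgetNeighbors v, ∃ j : Fin 3,
      searchColoring (fun a => (gadgetNeighbors a).filter (s(a, ·) ≠ s(v, w))) gadgetInnerVertices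
        (Sum.elim (fun i => if i = j then (1 : Fin 3) else 0) fun _ => 0) := by
    decide +kernel
  obtain ⟨j, hj⟩ := hsearch v w ((gadget_adj_iff v w).1 he)
  have hinner : ∀ a b, (gadget.deleteEdges {s(v, w)}).Adj a b →
      a ∈ gadgetInnerVertices ∨ b ∈ gadgetInnerVertices := by
    rintro (i | r) (i' | r') hab
    · simp [crown, crownRel] at hab
    all_goals simp only [inr_mem_gadgetInnerVertices, true_or, or_true]
  obtain ⟨C, hC⟩ := (searchColoring_eq_true_iff_exists_coloring
    (deleteEdges_adj_iff_mem_filter gadget_adj_iff s(v, w)) hinner).1 hj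
  exact ⟨j, C, fun i => hC (.inl i) (by simp [gadgetInnerVertices])⟩

theorem colorable_crown_deleteEdges_old (ht : ∀ i, G.Adj (t i) (t (i + 1))) {u v : V}
    (huv : ¬ (u ∈ range t ∧ v ∈ range t)) {k : ℕ} (h : (G.deleteEdges {s(u, v)}).Colorable k) :
    ((G.crown t).deleteEdges {s(.inl u, .inl v)}).Colorable k := by
  have ht' : ∀ i, (G.deleteEdges {s(u, v)}).Adj (t i) (t (i + 1)) := fun i =>
    deleteEdges_adj.2 ⟨ht i, fun hi => huv <| by
      obtain ⟨rfl, rfl⟩ | ⟨rfl, rfl⟩ := Sym2.eq_iff.1 hi <;> simp⟩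
  have hle : (G.crown t).deleteEdges {s(.inl u, .inl v)} ≤ (G.deleteEdges {s(u, v)}).crown t := by
    intro a b hab
    obtain ⟨hab, hne⟩ := deleteEdges_adj.1 hab
    rcases crown_adj_iff.1 hab with ⟨a', b', hadj, hside, rfl, rfl⟩ | hw
    · have hadj' : (G.deleteEdges {s(u, v)}).Adj a' b' :=
        deleteEdges_adj.2 ⟨hadj, fun h => hne (congrArg (Sym2.map Sum.inl) h)⟩
      exact crown_adj_iff.2 (.inl ⟨a', b', hadj', hside, rfl, rfl⟩)
    · exact crown_adj_iff.2 (.inr hw)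
  exact (h.of_hom (crownFoldHom ht')).mono_left hle

theorem colorable_crown_deleteEdges_ofGadget (ht : ∀ i, G.Adj (t i) (t (i + 1)))
    (hG : ¬ G.Colorable 3) (hdel : ∀ e ∈ G.edgeSet, (G.deleteEdges {e}).Colorable 3)
    {w w' : CrownVertex (Fin 3)} (hw : gadget.Adj w w') :
    ((G.crown t).deleteEdges {s(ofGadget t w, ofGadget t w')}).Colorable 3 := by
  obtain ⟨j, C₀, hC₀⟩ := exists_coloring_gadget_deleteEdges (e := s(w, w')) hw
  obtain ⟨C, hC⟩ := exists_coloring_deleteEdges_side ht hG j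
    (hdel _ (adj_of_adj_succ ht (by simp)))
  have hofGadget : ∀ a, Sum.elim C (C₀ ∘ .inr) (ofGadget t a) = C₀ a := by
    rintro (i | r)
    exacts [(hC i).trans (hC₀ i).symm, rfl]
  refine ⟨Coloring.mk (Sum.elim C (C₀ ∘ .inr)) fun {a b} hab => ?_⟩
  obtain ⟨hab, hne⟩ := deleteEdges_adj.1 hab
  rcases crown_adj_iff.1 hab with ⟨u, v, huv, hside, rfl, rfl⟩ | ⟨a, b, hadj, rfl, rfl⟩
  · refine C.valid (deleteEdges_adj.2 ⟨huv, fun h => hside ?_⟩)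
    obtain ⟨rfl, rfl⟩ | ⟨rfl, rfl⟩ := Sym2.eq_iff.1 h <;> simp
  · rw [hofGadget, hofGadget]
    exact C₀.valid (deleteEdges_adj.2 ⟨hadj, fun h => hne (congrArg (Sym2.map (ofGadget t)) h)⟩)

theorem isEdgeCritical_crown (ht : ∀ i, G.Adj (t i) (t (i + 1))) (hG : G.IsEdgeCritical 4) :
    (G.crown t).IsEdgeCritical 4 := by
  obtain ⟨hcol, hdel⟩ := (isEdgeCritical_succ_iff_of_adj (ht 0)).1 hG
  have hadj : (G.crown t).Adj (crownTriangle V 0) (crownTriangle V 1) := by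
    simp [crown, crownRel, crownTriangle]
  refine (isEdgeCritical_succ_iff_of_adj hadj).2
    ⟨fun h => hcol (colorable_three_of_crown h), fun e he => ?_⟩
  induction e with | _ a b
  rcases crown_adj_iff.1 he with ⟨u, v, huv, hside, rfl, rfl⟩ | ⟨w, w', hw, rfl, rfl⟩
  · exact colorable_crown_deleteEdges_old ht hside (hdel s(u, v) huv)
  · exact colorable_crown_deleteEdges_ofGadget ht hcol hdel hw

end CrownColoring

section CrownDegree

variable {V : Type*} {G : SimpleGraph V} {t : Fin 3 → V}

theorem neighborSet_crown_inr (r : Fin 3 ⊕ Fin 3 ⊕ Fin 3) :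
    (G.crown t).neighborSet (.inr r) = ofGadget t '' gadget.neighborSet (.inr r) := by
  ext b
  rw [mem_neighborSet, crown_adj_iff]
  constructor
  · rintro (⟨u, v, -, -, h, -⟩ | ⟨i | r', w', hw, h, rfl⟩)
    · simp at h
    · simp at h
    · cases h
      exact ⟨w', hw, rfl⟩
  · rintro ⟨w', hw, rfl⟩
    exact .inr ⟨_, w', hw, rfl, rfl⟩

theorem neighborSet_crown_inl_of_notMem {u : V} (hu : u ∉ range t) :
    (G.crown t).neighborSet (.inl u) = .inl '' G.neighborSet u := by
  ext b
  rw [mem_neighborSet, crown_adj_iff]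
  constructor
  · rintro (⟨u', v, huv, -, h, rfl⟩ | ⟨i | r', w', -, h, rfl⟩)
    · cases h
      exact ⟨v, huv, rfl⟩
    · cases h
      exact absurd (mem_range_self i) hu
    · simp at h
  · rintro ⟨v, hv, rfl⟩
    exact .inl ⟨u, v, hv, fun h => hu h.1, rfl, rfl⟩

theorem neighborSet_crown_corner (ht : Function.Injective t) (i : Fin 3) :
    (G.crown t).neighborSet (.inl (t i)) =
      .inl '' (G.neighborSet (t i) \ range t) ∪ ofGadget t '' gadget.neighborSet (.inl i) := by
  ext b
  rw [mem_neighborSet, crown_adj_iff]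
  constructor
  · rintro (⟨u, v, huv, hside, h, rfl⟩ | ⟨j | r', w', hw, h, rfl⟩)
    · cases h
      exact .inl ⟨v, ⟨huv, fun hv => hside ⟨mem_range_self i, hv⟩⟩, rfl⟩
    · obtain rfl := ht (Sum.inl_injective h)
      exact .inr ⟨w', hw, rfl⟩
    · simp at h
  · rintro (⟨v, ⟨hv, hvt⟩, rfl⟩ | ⟨w', hw, rfl⟩)
    · exact .inl ⟨t i, v, hv, fun h => hvt h.2, rfl, rfl⟩
    · exact .inr ⟨_, w', hw, rfl, rfl⟩

theorem encard_neighborSet_inter_range (ht : ∀ i, G.Adj (t i) (t (i + 1))) (i : Fin 3) :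
    (G.neighborSet (t i) ∩ range t).encard = 2 := by
  have himage : G.neighborSet (t i) ∩ range t = t '' {i}ᶜ := by
    ext v
    constructor
    · rintro ⟨hv, j, rfl⟩
      exact ⟨j, (ne_of_apply_ne t hv.ne).symm, rfl⟩
    · rintro ⟨j, hj, rfl⟩
      exact ⟨adj_of_adj_succ ht (Ne.symm hj), mem_range_self j⟩
  rw [himage, (injective_of_adj_succ ht).encard_image, ← Finset.coe_singleton, ← Finset.coe_compl,
    encard_coe_eq_coe_finsetCard, Finset.card_compl]
  simp

theorem encard_neighborSet_gadget_corner (i : Fin 3) :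
    (gadget.neighborSet (.inl i)).encard = 2 := by
  rw [encard_neighborSet_eq_card_toFinset gadget_adj_iff]
  simp [gadgetNeighbors]

theorem encard_neighborSet_gadget_inr (r : Fin 3 ⊕ Fin 3 ⊕ Fin 3) :
    (gadget.neighborSet (.inr r)).encard = 4 := by
  have hcard : (gadgetNeighbors (.inr r)).toFinset.card = 4 := by
    rcases r with i | i | i <;> decide +revert
  rw [encard_neighborSet_eq_card_toFinset gadget_adj_iff, hcard, Nat.cast_ofNat]

theorem encard_neighborSet_crown_inr (ht : Function.Injective t) (r : Fin 3 ⊕ Fin 3 ⊕ Fin 3) :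
    ((G.crown t).neighborSet (.inr r)).encard = 4 := by
  rw [neighborSet_crown_inr, (ofGadget_injective ht).encard_image, encard_neighborSet_gadget_inr]

theorem encard_neighborSet_crown_inl (ht : ∀ i, G.Adj (t i) (t (i + 1))) (u : V) :
    ((G.crown t).neighborSet (.inl u)).encard = (G.neighborSet u).encard := by
  by_cases hu : u ∈ range t
  · obtain ⟨i, rfl⟩ := hu
    have htinj := injective_of_adj_succ ht
    have hdisj : Disjoint (Sum.inl '' (G.neighborSet (t i) \ range t))
        (ofGadget t '' gadget.neighborSet (.inl i)) := by
      rw [Set.disjoint_left]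
      rintro _ ⟨v, -, rfl⟩ ⟨j | r, hj, h⟩
      · simp [crown, crownRel] at hj
      · simp at h
    rw [neighborSet_crown_corner htinj, encard_union_eq hdisj, Sum.inl_injective.encard_image,
      (ofGadget_injective htinj).encard_image, encard_neighborSet_gadget_corner,
      ← encard_neighborSet_inter_range ht i, encard_sdiff_add_encard_inter]
  · rw [neighborSet_crown_inl_of_notMem hu, Sum.inl_injective.encard_image]

end CrownDegree

section CrownSeed

/-- The properties that a graph with a distinguished triangle passes on to its crowning. -/
structure CrownSeed {V : Type*} (G : SimpleGraph V) (t : Fin 3 → V) : Prop where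
  adj_succ : ∀ i, G.Adj (t i) (t (i + 1))
  encard_neighborSet : ∀ v, (G.neighborSet v).encard = 4
  isEdgeCritical : G.IsEdgeCritical 4
  exists_isFoldColoring : ∃ c, G.IsFoldColoring 2 6 c
  exists_triangleDrawing : ∃ p : V → ℝ × ℝ, TriangleDrawing G t p

theorem crownSeed_baseGraph : CrownSeed baseGraph baseTriangle where
  adj_succ := baseGraph_adj_baseTriangle
  encard_neighborSet := encard_neighborSet_baseGraph
  isEdgeCritical := isEdgeCritical_baseGraph
  exists_isFoldColoring := ⟨_, isFoldColoring_baseGraph⟩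
  exists_triangleDrawing := ⟨_, triangleDrawing_baseGraph⟩

namespace CrownSeed

variable {V W : Type*} {G : SimpleGraph V} {H : SimpleGraph W} {t : Fin 3 → V}

theorem crown (h : CrownSeed G t) : CrownSeed (G.crown t) (crownTriangle V) where
  adj_succ i := by simp [SimpleGraph.crown, crownRel, crownTriangle]
  encard_neighborSet a := by
    rcases a with u | r
    · rw [encard_neighborSet_crown_inl h.adj_succ, h.encard_neighborSet]
    · exact encard_neighborSet_crown_inr (injective_of_adj_succ h.adj_succ) r
  isEdgeCritical := isEdgeCritical_crown h.adj_succ h.isEdgeCritical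
  exists_isFoldColoring := h.exists_isFoldColoring.imp' _ fun _ hc =>
    isFoldColoring_comp_hom hc (crownFoldHom h.adj_succ)
  exists_triangleDrawing := h.exists_triangleDrawing.elim fun _ => TriangleDrawing.exists_crown

theorem map_iso (h : CrownSeed G t) (e : G ≃g H) : CrownSeed H (e ∘ t) where
  adj_succ i := e.map_adj_iff.2 (h.adj_succ i)
  encard_neighborSet w := by
    rw [← h.encard_neighborSet (e.symm w)]
    exact encard_congr (e.symm.mapNeighborSet w)
  isEdgeCritical := isEdgeCritical_of_iso e h.isEdgeCritical
  exists_isFoldColoring := h.exists_isFoldColoring.imp' _ fun _ hc =>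
    isFoldColoring_comp_hom hc e.symm.toHom
  exists_triangleDrawing := h.exists_triangleDrawing.imp' _ fun _ D => D.map_iso e

theorem isPlanar (h : CrownSeed G t) : G.IsPlanar :=
  let ⟨_, D⟩ := h.exists_triangleDrawing
  ⟨D.toPlaneDrawing⟩

theorem exists_isFacialTriangle (h : CrownSeed G t) : ∃ D : PlaneDrawing G, D.IsFacialTriangle t :=
  let ⟨_, D⟩ := h.exists_triangleDrawing
  ⟨D.toPlaneDrawing, D.isFacialTriangle h.adj_succ⟩

theorem isRegularOfDegree (h : CrownSeed G t) [G.LocallyFinite] : G.IsRegularOfDegree 4 := by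
  intro v
  rw [← Nat.cast_inj (R := ℕ∞), ← card_neighborFinset_eq_degree, ← encard_coe_eq_coe_finsetCard,
    coe_neighborFinset, h.encard_neighborSet, Nat.cast_ofNat]

theorem fractionalChromaticNumber_eq [Finite V] (h : CrownSeed G t) :
    G.fractionalChromaticNumber = 3 := by
  simpa using fractionalChromaticNumber_eq_card (triangleHom h.adj_succ) two_pos
    h.exists_isFoldColoring

end CrownSeed

/-- The graphs of the sequence, each with the triangle for the next crowning. -/
noncomputable def crownSequence : ∀ k : ℕ,
    {X : SimpleGraph (Fin (18 + 9 * k)) × (Fin 3 → Fin (18 + 9 * k)) // CrownSeed X.1 X.2}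
  | 0 => ⟨(baseGraph, baseTriangle), crownSeed_baseGraph⟩
  | k + 1 =>
    let X := crownSequence k
    let e : CrownVertex (Fin (18 + 9 * k)) ≃ Fin (18 + 9 * (k + 1)) :=
      Fintype.equivFinOfCardEq (by simp; ring)
    ⟨((X.1.1.crown X.1.2).map e.toEmbedding, e ∘ crownTriangle _),
      X.2.crown.map_iso (Iso.map e _)⟩

theorem nonempty_iso_crownSequence_succ (k : ℕ) : Nonempty ((crownSequence (k + 1)).1.1 ≃g
    (crownSequence k).1.1.crown (crownSequence k).1.2) :=
  ⟨(Iso.map _ _).symm⟩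

end CrownSeed

theorem mainTheorem3 :
    (∃ (G : ∀ k : ℕ, SimpleGraph (Fin (18 + 9 * k))) (_ : ∀ k, DecidableRel (G k).Adj),
      (∀ k, (G k).IsPlanar ∧ (G k).IsRegularOfDegree 4 ∧ (G k).IsEdgeCritical 4 ∧
        (G k).fractionalChromaticNumber = 3) ∧
      (∀ k, ∃ (D : PlaneDrawing (G k)) (t : Fin 3 → Fin (18 + 9 * k)),
        D.IsFacialTriangle t ∧ Nonempty (G (k + 1) ≃g (G k).crown t))) ∧
    ¬ (∀ (n : ℕ) (H : SimpleGraph (Fin n)), H.IsPlanar → H.chromaticNumber = 4 →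
        3 < H.fractionalChromaticNumber) := by
  classical
  refine ⟨⟨fun k => (crownSequence k).1.1, fun _ => inferInstance, fun k => ?_, fun k => ?_⟩,
    fun hall => ?_⟩
  · have h := (crownSequence k).2
    exact ⟨h.isPlanar, h.isRegularOfDegree, h.isEdgeCritical, h.fractionalChromaticNumber_eq⟩
  · obtain ⟨D, hD⟩ := (crownSequence k).2.exists_isFacialTriangle
    exact ⟨D, _, hD, nonempty_iso_crownSequence_succ k⟩
  · have h := crownSeed_baseGraph
    exact (hall _ _ h.isPlanar h.isEdgeCritical.1).ne' h.fractionalChromaticNumber_eq
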